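/- Let $(d_j)_{j\ge 0}$ be a sequence of positive real numbers, put $c_j = 1 + d_j^2$, and let $J$ be the semi-infinite tridiagonal matrix \[ J=\begin{pmatrix} c_0 & d_0 & & \\ d_0 & c_1 & d_1 & \\ & d_1 & c_2 & \ddots \\ & & \ddots & \ddots \end{pmatrix}. \] Let $\ell^2$ be the Hilbert space of complex square summable sequences $x=(x_0,x_1,\dots)$ with inner product $(x,y)=\sum_{i\ge 0} x_i\overline{y_i}$, and denote by $J$ also the minimal closed operator in $\ell^2$ generated by this matrix, that is, the closure of the operator $x\mapsto Jx$ defined on the finitely supported sequences. Then the operator $J$ is self-adjoint and positive, that is, \[ (Jx,x)>0 \quad\text{for all } x\in\operatorname{dom} J\setminus\{0\}. \] In particular, $\ker J=\{0\}$. -/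

import Mathlib

open scoped ComplexOrder

noncomputable section

namespace JacobiOperator

/-- The Hilbert space `ℓ²` of complex square summable sequences `(x₀, x₁, …)`. -/
abbrev Ell2 : Type := lp (fun _ : ℕ => ℂ) 2

/-- The subspace of finitely supported sequences in `ℓ²`. -/
def finitelySupported : Submodule ℂ Ell2 where
  carrier := {x | (Function.support (x : ℕ → ℂ)).Finite}
  zero_mem' := by simp [Function.support]
  add_mem' := by
    intro x y hx hy
    refine (Set.Finite.union hx hy).subset ?_
    rw [lp.coeFn_add]
    exact Function.support_add _ _
  smul_mem' := by
    intro a x hx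
    refine Set.Finite.subset hx ?_
    rw [lp.coeFn_smul]
    exact Function.support_const_smul_subset a _

/-- The semi-infinite tridiagonal matrix with diagonal `c₀, c₁, …` and off-diagonal
`d₀, d₁, …` (both above and below the diagonal). -/
def tridiagonal (c d : ℕ → ℝ) : Matrix ℕ ℕ ℂ := fun i j =>
  if i = j then (c i : ℂ)
  else if j = i + 1 then (d i : ℂ)
  else if i = j + 1 then (d j : ℂ)
  else 0

/-- Every column of a tridiagonal matrix has finitely many nonzero entries. -/
theorem tridiagonal_column_finite (c d : ℕ → ℝ) (j : ℕ) :
    (Function.support fun i => tridiagonal c d i j).Finite := by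
  refine (Set.finite_Iic (j + 1)).subset ?_
  intro i hi
  by_contra h
  simp only [Set.mem_Iic, not_le] at h
  apply hi
  have h1 : i ≠ j := by omega
  have h2 : j ≠ i + 1 := by omega
  have h3 : i ≠ j + 1 := by omega
  simp [tridiagonal, h1, h2, h3]

/-- Terms of the matrix-vector product vanish off the support of the vector. -/
theorem summable_row (A : Matrix ℕ ℕ ℂ) (x : finitelySupported) (i : ℕ) :
    Summable fun j => A i j * (x : Ell2) j := by
  refine summable_of_hasFiniteSupport (Set.Finite.subset x.2 ?_)
  intro j hj h
  exact hj (by simp [h])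

/-- A column-finite matrix maps finitely supported sequences to finitely supported ones. -/
theorem mulVec_support_finite (A : Matrix ℕ ℕ ℂ)
    (hA : ∀ j, (Function.support fun i => A i j).Finite) (x : finitelySupported) :
    (Function.support fun i => ∑' j, A i j * (x : Ell2) j).Finite := by
  refine (Set.Finite.biUnion x.2 fun j _ => hA j).subset ?_
  intro i hi
  by_contra h
  apply hi
  have h0 : ∀ j, A i j * (x : Ell2) j = 0 := by
    intro j
    by_contra hj
    exact h (Set.mem_biUnion (x := j) (right_ne_zero_of_mul hj) (left_ne_zero_of_mul hj))
  simp [h0]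

/-- The operator `x ↦ A x` (matrix times column vector) with domain the finitely supported
sequences, for a matrix `A` with finitely many nonzero entries in each column. -/
def preminimal (A : Matrix ℕ ℕ ℂ) (hA : ∀ j, (Function.support fun i => A i j).Finite) :
    Ell2 →ₗ.[ℂ] Ell2 where
  domain := finitelySupported
  toFun :=
    { toFun := fun x =>
        ⟨fun i => ∑' j, A i j * (x : Ell2) j,
          (memℓp_zero (mulVec_support_finite A hA x)).of_exponent_ge zero_le⟩
      map_add' := by
        intro x y
        ext i
        simp only [Submodule.coe_add, lp.coeFn_add, Pi.add_apply, mul_add]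
        exact (summable_row A x i).tsum_add (summable_row A y i)
      map_smul' := by
        intro a x
        ext i
        simp only [Submodule.coe_smul, lp.coeFn_smul, Pi.smul_apply, smul_eq_mul,
          RingHom.id_apply, mul_left_comm _ a]
        exact tsum_mul_left }

/-- The minimal closed operator in `ℓ²` generated by the tridiagonal matrix with diagonal `c`
and off-diagonal `d`: the closure of the matrix operator on finitely supported sequences. -/
def minimalOperator (c d : ℕ → ℝ) : Ell2 →ₗ.[ℂ] Ell2 :=
  (preminimal (tridiagonal c d) (tridiagonal_column_finite c d)).closure

end JacobiOperator

end

/-! Formally `J = A*A` with `A` bidiagonal: `(Ax)₀ = x₀`, `(Ax)ᵢ₊₁ = dᵢxᵢ + xᵢ₊₁`. Hence `(Jx,x)`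
dominates every partial sum of `‖Ax‖²` (`sum_normSq_le_re_inner_minimalOperator`), and `Ax = 0`
forces `x = 0` coordinate by coordinate, which gives positivity. A closed symmetric nonnegative
operator is self-adjoint once the range of `J + 1` has zero orthogonal complement. A vector in that
complement solves `Ju = -u` formally, and the factorization makes `|uⱼ|` nondecreasing
(`norm_le_norm_succ_of_formalAction_eq_neg`), so only `u = 0` is square summable. -/

open scoped ComplexConjugate
open Filter Topology

/-! ### Symmetric and nonnegative unbounded operators -/

namespace LinearPMap

variable {𝕜 E : Type*} [RCLike 𝕜] [NormedAddCommGroup E] [InnerProductSpace 𝕜 E]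
  {T : E →ₗ.[𝕜] E}

theorem IsClosable.mk_mem_closure_graph (h : T.IsClosable) (x : T.closure.domain) :
    ((x : E), T.closure x) ∈ _root_.closure (T.graph : Set (E × E)) := by
  have := T.closure.mem_graph x
  rwa [← h.graph_closure_eq_closure_graph] at this

variable [CompleteSpace E]

/-- A densely defined symmetric operator is closable. -/
theorem IsFormalAdjoint.isClosable (hT : Dense (T.domain : Set E)) (h : T.IsFormalAdjoint T) :
    T.IsClosable :=
  (adjoint_isClosed hT).isClosable.leIsClosable (h.le_adjoint hT)

/-- The closure of a densely defined symmetric operator is symmetric. -/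
theorem IsFormalAdjoint.closure (hT : Dense (T.domain : Set E)) (h : T.IsFormalAdjoint T) :
    T.closure.IsFormalAdjoint T.closure := by
  intro x y
  have hcl := h.isClosable hT
  -- The symmetry defect is jointly continuous on pairs of graph points and vanishes on the graph of
  -- `T`, hence on its closure.
  have hzero := map_mem_closure₂ (u := ({0} : Set 𝕜))
    (f := fun p q : E × E => inner 𝕜 p.2 q.1 - inner 𝕜 p.1 q.2)
    (by unfold Function.uncurry; fun_prop) (hcl.mk_mem_closure_graph x)
    (hcl.mk_mem_closure_graph y) (by
      intro p hp q hq
      obtain ⟨a, rfl⟩ := (T.mem_graph_iff').1 hp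
      obtain ⟨b, rfl⟩ := (T.mem_graph_iff').1 hq
      simpa [sub_eq_zero] using h a b)
  simpa [sub_eq_zero] using hzero

/-- A symmetric operator `T` for which `T + 1` is onto is self-adjoint. -/
theorem IsFormalAdjoint.isSelfAdjoint_of_surjective (hT : Dense (T.domain : Set E))
    (h : T.IsFormalAdjoint T) (hsurj : ∀ z : E, ∃ x : T.domain, (x : E) + T x = z) :
    IsSelfAdjoint T := by
  have hle : T ≤ T.adjoint := h.le_adjoint hT
  refine isSelfAdjoint_def.2 (le_antisymm (le_of_le_graph ?_) hle)
  intro p hp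
  obtain ⟨y, rfl⟩ := (mem_graph_iff' _).1 hp
  -- This `x` is the candidate for `y` itself: `y - x` will be orthogonal to the range of `T + 1`,
  -- which is everything.
  obtain ⟨x, hx⟩ := hsurj (y + T.adjoint y)
  have horth : ∀ u : T.domain, inner 𝕜 ((y : E) - x) ((u : E) + T u) = 0 := by
    intro u
    have hy := adjoint_isFormalAdjoint hT y u
    have hxu := h x u
    calc inner 𝕜 ((y : E) - x) ((u : E) + T u)
        = inner 𝕜 ((y : E) + T.adjoint y) (u : E) - inner 𝕜 ((x : E) + T x) (u : E) := by
          simp only [inner_sub_left, inner_add_right, inner_add_left, hy, hxu]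
          ring
      _ = 0 := by rw [hx, sub_self]
  obtain ⟨u, hu⟩ := hsurj ((y : E) - x)
  have hyx : (y : E) = x := by
    have := horth u
    rw [hu, inner_self_eq_zero, sub_eq_zero] at this
    exact this
  have hval : T.adjoint y = T x := by
    rw [hyx] at hx
    exact (add_left_cancel hx).symm
  rw [hyx, hval]
  exact T.mem_graph x

/-- For a closed nonnegative operator `T` the range of `T + 1` is closed. -/
theorem IsClosed.isClosed_range_add (hcl : T.IsClosed)
    (hpos : ∀ x : T.domain, 0 ≤ RCLike.re (inner 𝕜 (x : E) (T x))) :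
    _root_.IsClosed (Set.range fun x : T.domain => (x : E) + T x) := by
  have hcl' : _root_.IsClosed (T.graph : Set (E × E)) := hcl
  have : CompleteSpace T.graph := hcl'.completeSpace_coe
  let f : T.graph →L[𝕜] E :=
    (ContinuousLinearMap.fst 𝕜 E E + ContinuousLinearMap.snd 𝕜 E E).comp T.graph.subtypeL
  -- Nonnegativity gives `‖x + Tx‖² ≥ ‖x‖² + ‖Tx‖²`, so `f` is bounded below on the complete space
  -- `T.graph`; the factor 2 leaves slack.
  have hbound : ∀ p : T.graph, ‖p‖ ≤ (2 : NNReal) * ‖f p‖ := by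
    rintro ⟨p, hp⟩
    obtain ⟨x, rfl⟩ := (mem_graph_iff' _).1 hp
    change ‖((x : E), T x)‖ ≤ (2 : ℝ) * ‖(x : E) + T x‖
    have hsq := norm_add_sq (𝕜 := 𝕜) (x : E) (T x)
    have hx := hpos x
    have h1 : ‖(x : E)‖ ≤ ‖(x : E) + T x‖ :=
      le_of_sq_le_sq (by nlinarith [sq_nonneg ‖T x‖]) (norm_nonneg _)
    have h2 : ‖T x‖ ≤ ‖(x : E) + T x‖ :=
      le_of_sq_le_sq (by nlinarith [sq_nonneg ‖(x : E)‖]) (norm_nonneg _)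
    refine (max_le h1 h2).trans ?_
    linarith [norm_nonneg ((x : E) + T x)]
  have hanti : AntilipschitzWith 2 f := AddMonoidHomClass.antilipschitz_of_bound f hbound
  convert! hanti.isClosed_range f.uniformContinuous using 1
  ext z
  constructor
  · rintro ⟨x, rfl⟩
    exact ⟨⟨_, T.mem_graph x⟩, rfl⟩
  · rintro ⟨⟨p, hp⟩, rfl⟩
    obtain ⟨x, rfl⟩ := (mem_graph_iff' _).1 hp
    exact ⟨x, rfl⟩

/-- A closed symmetric nonnegative operator `T` is self-adjoint if only `0` is orthogonal to the
range of `T + 1`. -/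
theorem IsFormalAdjoint.isSelfAdjoint_of_nonneg (hT : Dense (T.domain : Set E))
    (h : T.IsFormalAdjoint T) (hcl : T.IsClosed)
    (hpos : ∀ x : T.domain, 0 ≤ RCLike.re (inner 𝕜 (x : E) (T x)))
    (hker : ∀ y : E, (∀ x : T.domain, inner 𝕜 y ((x : E) + T x) = 0) → y = 0) :
    IsSelfAdjoint T := by
  refine h.isSelfAdjoint_of_surjective hT fun z => ?_
  let K : Submodule 𝕜 E := LinearMap.range (T.domain.subtype + T.toFun)
  have hK : _root_.IsClosed (K : Set E) := hcl.isClosed_range_add hpos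
  have : CompleteSpace K := hK.completeSpace_coe
  have htop : K = ⊤ := by
    refine Submodule.orthogonal_eq_bot_iff.1 ((Submodule.eq_bot_iff _).2 fun y hy => ?_)
    exact hker y fun x =>
      Submodule.inner_left_of_mem_orthogonal (K := K) (LinearMap.mem_range_self _ x) hy
  have hz : z ∈ K := htop ▸ Submodule.mem_top
  exact hz

end LinearPMap

noncomputable section

/-! ### The matrix on finitely supported sequences -/

namespace JacobiOperator

theorem single_mem_finitelySupported (k : ℕ) (a : ℂ) :
    (lp.single 2 k a : Ell2) ∈ finitelySupported := by
  refine (Set.finite_singleton k).subset fun j hj => ?_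
  by_contra hne
  exact hj (lp.single_apply_ne _ _ _ hne)

theorem dense_finitelySupported : Dense (finitelySupported : Set Ell2) := by
  intro x
  refine mem_closure_of_tendsto (lp.hasSum_single (by simp) x) (Eventually.of_forall fun s => ?_)
  exact Submodule.sum_mem _ fun i _ => single_mem_finitelySupported i (x i)

/-- The formal action of the tridiagonal matrix on an arbitrary sequence. -/
def formalAction (c d : ℕ → ℝ) (x : ℕ → ℂ) : ℕ → ℂ
  | 0 => c 0 * x 0 + d 0 * x 1
  | k + 1 => d k * x k + c (k + 1) * x (k + 1) + d (k + 1) * x (k + 2)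

/-- The operator generated by the tridiagonal matrix on finitely supported sequences. -/
abbrev finiteOperator (c d : ℕ → ℝ) : Ell2 →ₗ.[ℂ] Ell2 :=
  preminimal (tridiagonal c d) (tridiagonal_column_finite c d)

theorem finiteOperator_apply (c d : ℕ → ℝ) (x : finitelySupported) (i : ℕ) :
    (finiteOperator c d x : Ell2) i = formalAction c d (x : Ell2) i := by
  change ∑' j, tridiagonal c d i j * (x : Ell2) j = _
  cases i with
  | zero =>
    rw [tsum_eq_sum (s := {0, 1})]
    · simp [tridiagonal, formalAction]
    · intro j hj
      simp only [Finset.mem_insert, Finset.mem_singleton, not_or] at hj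
      have h1 : (0 : ℕ) ≠ j := by omega
      simp [tridiagonal, h1, hj.2]
  | succ k =>
    rw [tsum_eq_sum (s := {k, k + 1, k + 2})]
    · simp [tridiagonal, formalAction, add_assoc]
    · intro j hj
      simp only [Finset.mem_insert, Finset.mem_singleton, not_or] at hj
      have h1 : k + 1 ≠ j := by omega
      have h2 : j ≠ k + 1 + 1 := by omega
      have h3 : k + 1 ≠ j + 1 := by omega
      simp only [tridiagonal, if_neg h1, if_neg h2, if_neg h3, zero_mul]

/-- Green's formula for the tridiagonal matrix. -/
theorem sum_formalAction_mul_conj (c d : ℕ → ℝ) (x y : ℕ → ℂ) (n : ℕ) :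
    ∑ i ∈ Finset.range (n + 1), formalAction c d x i * conj (y i) =
      ∑ i ∈ Finset.range (n + 1), x i * conj (formalAction c d y i) +
        d n * (x (n + 1) * conj (y n) - x n * conj (y (n + 1))) := by
  induction n with
  | zero => simp [formalAction]; ring
  | succ n ih =>
    rw [Finset.sum_range_succ, ih, Finset.sum_range_succ _ (n + 1)]
    simp [formalAction]
    ring

/-- The quadratic form of the truncated matrix as a sum of squares and a boundary term. -/
theorem sum_formalAction_mul_conj_self (c d : ℕ → ℝ) (hc : ∀ j, c j = 1 + d j ^ 2) (x : ℕ → ℂ)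
    (n : ℕ) :
    ∑ i ∈ Finset.range (n + 1), formalAction c d x i * conj (x i) =
      x 0 * conj (x 0) +
        ∑ i ∈ Finset.range n, (d i * x i + x (i + 1)) * conj (d i * x i + x (i + 1)) +
        d n * (d n * x n + x (n + 1)) * conj (x n) := by
  induction n with
  | zero => simp [formalAction, hc]; ring
  | succ n ih =>
    rw [Finset.sum_range_succ, ih, Finset.sum_range_succ _ n]
    simp [formalAction, hc]
    ring

theorem eventually_eq_zero (x : finitelySupported) :
    ∃ N, ∀ n, N ≤ n → (x : Ell2) n = 0 := by
  obtain ⟨N, hN⟩ := x.2.bddAbove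
  refine ⟨N + 1, fun n hn => ?_⟩
  by_contra h
  have := hN h
  omega

theorem inner_finiteOperator_eq_sum (c d : ℕ → ℝ) (y : Ell2) (x : finitelySupported) {N n : ℕ}
    (hN : ∀ n, N ≤ n → (x : Ell2) n = 0) (hn : N ≤ n) :
    inner ℂ y (finiteOperator c d x) =
      ∑ i ∈ Finset.range (n + 1), formalAction c d (x : Ell2) i * conj (y i) := by
  -- The matrix can enlarge the support by one index, so index `n` must be included even though `x n
  -- = 0`.
  rw [lp.inner_eq_tsum, tsum_eq_sum (s := Finset.range (n + 1))]
  · refine Finset.sum_congr rfl fun i _ => ?_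
    rw [finiteOperator_apply, RCLike.inner_apply]
  · intro i hi
    rw [Finset.mem_range, not_lt] at hi
    obtain ⟨k, rfl⟩ : ∃ k, i = k + 1 := ⟨i - 1, by omega⟩
    rw [finiteOperator_apply, RCLike.inner_apply]
    simp [formalAction, hN k (by omega), hN (k + 1) (by omega), hN (k + 2) (by omega)]

theorem inner_finiteOperator_eq_sum_conj (c d : ℕ → ℝ) (y : Ell2) (x : finitelySupported)
    {N n : ℕ} (hN : ∀ n, N ≤ n → (x : Ell2) n = 0) (hn : N ≤ n) :
    inner ℂ y (finiteOperator c d x) =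
      ∑ i ∈ Finset.range (n + 1), (x : Ell2) i * conj (formalAction c d y i) := by
  rw [inner_finiteOperator_eq_sum c d y x hN hn, sum_formalAction_mul_conj, hN n hn,
    hN (n + 1) (by omega)]
  simp

theorem finiteOperator_isFormalAdjoint (c d : ℕ → ℝ) :
    (finiteOperator c d).IsFormalAdjoint (finiteOperator c d) := by
  intro x y
  obtain ⟨N, hN⟩ := eventually_eq_zero x
  obtain ⟨M, hM⟩ := eventually_eq_zero y
  rw [← inner_conj_symm,
    inner_finiteOperator_eq_sum_conj c d (y : Ell2) x hN (le_max_left N M),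
    inner_finiteOperator_eq_sum c d (x : Ell2) y hM (le_max_right N M), map_sum]
  refine Finset.sum_congr rfl fun i _ => ?_
  simp [mul_comm]

theorem sum_normSq_le_re_inner_finiteOperator (c d : ℕ → ℝ) (hc : ∀ j, c j = 1 + d j ^ 2)
    (x : finitelySupported) (m : ℕ) :
    ‖(x : Ell2) 0‖ ^ 2 +
        ∑ i ∈ Finset.range m, ‖d i * (x : Ell2) i + (x : Ell2) (i + 1)‖ ^ 2 ≤
      (inner ℂ (x : Ell2) (finiteOperator c d x)).re := by
  obtain ⟨N, hN⟩ := eventually_eq_zero x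
  -- Cutting at `max N m` kills the boundary term; the squares with index at least `m` are then
  -- dropped.
  rw [inner_finiteOperator_eq_sum c d (x : Ell2) x hN (le_max_left N m),
    sum_formalAction_mul_conj_self c d hc, hN (max N m) (le_max_left _ _)]
  simp only [map_zero, mul_zero, add_zero, Complex.mul_conj, Complex.add_re, Complex.re_sum,
    Complex.ofReal_re, Complex.normSq_eq_norm_sq]
  gcongr
  exact le_max_right _ _

theorem finiteOperator_isClosable (c d : ℕ → ℝ) : (finiteOperator c d).IsClosable :=
  (finiteOperator_isFormalAdjoint c d).isClosable dense_finitelySupported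

/-! ### Positivity of the closure -/

/-- For fixed `m` only finitely many coordinates enter, so the inequality is a closed condition on
the graph and survives the closure. -/
theorem sum_normSq_le_re_inner_minimalOperator (c d : ℕ → ℝ) (hc : ∀ j, c j = 1 + d j ^ 2)
    (x : (minimalOperator c d).domain) (m : ℕ) :
    ‖(x : Ell2) 0‖ ^ 2 +
        ∑ i ∈ Finset.range m, ‖d i * (x : Ell2) i + (x : Ell2) (i + 1)‖ ^ 2 ≤
      (inner ℂ (x : Ell2) (minimalOperator c d x)).re := by
  have hcoord : ∀ i : ℕ, Continuous fun p : Ell2 × Ell2 => p.1 i := fun i =>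
    (lp.lipschitzWith_one_eval 2 i).continuous.comp continuous_fst
  have hclosed : IsClosed {p : Ell2 × Ell2 | ‖p.1 0‖ ^ 2 +
      ∑ i ∈ Finset.range m, ‖d i * p.1 i + p.1 (i + 1)‖ ^ 2 ≤ (inner ℂ p.1 p.2).re} := by
    refine isClosed_le ?_ (Complex.continuous_re.comp (continuous_fst.inner continuous_snd))
    refine ((hcoord 0).norm.pow 2).add (continuous_finsetSum _ fun i _ => ?_)
    exact ((continuous_const.mul (hcoord i)).add (hcoord (i + 1))).norm.pow 2
  refine closure_minimal ?_ hclosed ((finiteOperator_isClosable c d).mk_mem_closure_graph x)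
  intro p hp
  obtain ⟨a, rfl⟩ := (LinearPMap.mem_graph_iff' _).1 hp
  exact sum_normSq_le_re_inner_finiteOperator c d hc a m

theorem minimalOperator_isFormalAdjoint (c d : ℕ → ℝ) :
    (minimalOperator c d).IsFormalAdjoint (minimalOperator c d) :=
  (finiteOperator_isFormalAdjoint c d).closure dense_finitelySupported

theorem re_inner_minimalOperator_nonneg (c d : ℕ → ℝ) (hc : ∀ j, c j = 1 + d j ^ 2)
    (x : (minimalOperator c d).domain) :
    0 ≤ (inner ℂ (x : Ell2) (minimalOperator c d x)).re :=
  (by positivity : (0 : ℝ) ≤ _).trans (sum_normSq_le_re_inner_minimalOperator c d hc x 0)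

theorem inner_minimalOperator_pos (c d : ℕ → ℝ) (hc : ∀ j, c j = 1 + d j ^ 2)
    (x : (minimalOperator c d).domain) (hx : x ≠ 0) :
    0 < inner ℂ (x : Ell2) (minimalOperator c d x) := by
  -- The order on `ℂ` also demands a vanishing imaginary part, which symmetry supplies.
  have him : (inner ℂ (x : Ell2) (minimalOperator c d x)).im = 0 := by
    rw [← Complex.conj_eq_iff_im, inner_conj_symm]
    exact minimalOperator_isFormalAdjoint c d x x
  rw [Complex.lt_def]
  refine ⟨lt_of_le_of_ne (re_inner_minimalOperator_nonneg c d hc x) fun h0 => hx ?_, him.symm⟩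
  have hle := sum_normSq_le_re_inner_minimalOperator c d hc x
  rw [← h0] at hle
  have hzero : ∀ i, (x : Ell2) i = 0 := by
    intro i
    induction i with
    | zero =>
      have := hle 0
      rw [Finset.sum_range_zero, add_zero] at this
      exact norm_eq_zero.1 (pow_eq_zero_iff two_ne_zero |>.1 (this.antisymm (by positivity)))
    | succ i ih =>
      have hi := Finset.single_le_sum (s := Finset.range (i + 1))
        (f := fun i => ‖d i * (x : Ell2) i + (x : Ell2) (i + 1)‖ ^ 2)
        (fun _ _ => by positivity) (Finset.self_mem_range_succ i)
      have hsq : ‖(x : Ell2) (i + 1)‖ ^ 2 ≤ 0 := by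
        have := hle (i + 1)
        simp only [ih, mul_zero, zero_add] at hi
        have h0 := sq_nonneg ‖(x : Ell2) 0‖
        simp only [Complex.zero_re] at this
        linarith
      exact norm_eq_zero.1 (pow_eq_zero_iff two_ne_zero |>.1 (hsq.antisymm (by positivity)))
  ext i
  simpa using hzero i

/-! ### Trivial deficiency space and self-adjointness -/

/-- Formal solutions of `J u = -u` have nondecreasing absolute values. -/
theorem norm_le_norm_succ_of_formalAction_eq_neg (c d : ℕ → ℝ) (hc : ∀ j, c j = 1 + d j ^ 2)
    (u : ℕ → ℂ) (hu : ∀ i, formalAction c d u i = -u i) (j : ℕ) :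
    ‖u j‖ ≤ ‖u (j + 1)‖ := by
  -- Here `e = Au`, and `he` is the equation `A*e = -u`. Together they yield recursions for `Re (eᵢ
  -- ūᵢ)` and `|uᵢ|²` with only nonnegative increments.
  let e : ℕ → ℂ := fun i => Nat.casesOn i (u 0) fun k => u (k + 1) + d k * u k
  have he : ∀ i, d i * (u (i + 1) + d i * u i) = -(e i + u i) := by
    intro i
    have hi := hu i
    cases i with
    | zero =>
      simp only [formalAction, hc] at hi
      push_cast at hi
      linear_combination hi
    | succ k =>
      simp only [formalAction, hc] at hi
      push_cast at hi
      change _ = -((u (k + 1) + d k * u k) + u (k + 1))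
      linear_combination hi
  have hform : ∀ i, (e (i + 1) * conj (u (i + 1))).re =
      ‖e (i + 1)‖ ^ 2 + ‖u i‖ ^ 2 + (e i * conj (u i)).re := by
    intro i
    have hei := he i
    change ((u (i + 1) + d i * u i) * conj (u (i + 1))).re = ‖u (i + 1) + d i * u i‖ ^ 2 + _ + _
    have hre := congrArg Complex.re hei
    have him := congrArg Complex.im hei
    simp only [← Complex.normSq_eq_norm_sq, Complex.normSq_apply]
    simp at hre him ⊢
    linear_combination -(u i).re * hre - (u i).im * him
  have hnonneg : ∀ i, 0 ≤ (e i * conj (u i)).re := by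
    intro i
    induction i with
    | zero =>
      change 0 ≤ (u 0 * conj (u 0)).re
      rw [Complex.mul_conj, Complex.ofReal_re]
      exact Complex.normSq_nonneg _
    | succ i ih =>
      rw [hform]
      positivity
  have hnorm : ‖u (j + 1)‖ ^ 2 = (e (j + 1) * conj (u (j + 1))).re + ‖u j‖ ^ 2 +
      (e j * conj (u j)).re + d j ^ 2 * ‖u j‖ ^ 2 := by
    have hej := he j
    change _ = ((u (j + 1) + d j * u j) * conj (u (j + 1))).re + _ + _ + _
    have hre := congrArg Complex.re hej
    have him := congrArg Complex.im hej
    simp only [← Complex.normSq_eq_norm_sq, Complex.normSq_apply]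
    simp at hre him ⊢
    linear_combination -(u j).re * hre - (u j).im * him
  refine le_of_sq_le_sq ?_ (norm_nonneg _)
  have h1 := hnonneg j
  have h2 := hnonneg (j + 1)
  have h3 : 0 ≤ d j ^ 2 * ‖u j‖ ^ 2 := by positivity
  linarith

theorem tendsto_norm_coord_zero (y : Ell2) : Tendsto (fun i => ‖y i‖) atTop (𝓝 0) := by
  have h := (lp.summable_inner (𝕜 := ℂ) y y).tendsto_atTop_zero.norm
  simp only [inner_self_eq_norm_sq_to_K] at h
  have h' : Tendsto (fun i => ‖y i‖ ^ 2) atTop (𝓝 0) := by simpa using h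
  simpa using h'.sqrt

/-- Testing against basis vectors gives `Jy = -y` coordinatewise; then `‖y i‖` is nondecreasing and
tends to 0. -/
theorem eq_zero_of_orthogonal_range (c d : ℕ → ℝ) (hc : ∀ j, c j = 1 + d j ^ 2) (y : Ell2)
    (hy : ∀ x : (finiteOperator c d).domain,
      inner ℂ y ((x : Ell2) + finiteOperator c d x) = 0) : y = 0 := by
  have hu : ∀ i, formalAction c d y i = -y i := by
    intro k
    have hmem := single_mem_finitelySupported k 1
    have hN : ∀ n, k + 1 ≤ n → (lp.single 2 k (1 : ℂ) : Ell2) n = 0 := fun n hn =>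
      lp.single_apply_ne _ _ _ (by omega)
    have hsingle : inner ℂ y (lp.single 2 k (1 : ℂ) : Ell2) = conj (y k) := by
      rw [lp.inner_single_right, RCLike.inner_apply, one_mul]
    have hop : inner ℂ y (finiteOperator c d ⟨_, hmem⟩) = conj (formalAction c d y k) := by
      refine (inner_finiteOperator_eq_sum_conj c d y ⟨_, hmem⟩ hN le_rfl).trans ?_
      rw [Finset.sum_eq_single_of_mem k (by simp)]
      · rw [lp.single_apply_self, one_mul]
      · intro j _ hj
        rw [lp.single_apply_ne _ _ _ hj, zero_mul]
    have h : conj (y k) + conj (formalAction c d y k) = 0 := by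
      rw [← hsingle, ← hop, ← inner_add_right]
      exact hy ⟨_, hmem⟩
    rw [← map_add, map_eq_zero] at h
    linear_combination h
  have hmono : Monotone fun i => ‖y i‖ :=
    monotone_nat_of_le_succ (norm_le_norm_succ_of_formalAction_eq_neg c d hc y hu)
  ext i
  exact norm_le_zero_iff.1 (hmono.ge_of_tendsto (tendsto_norm_coord_zero y) i)

theorem minimalOperator_isSelfAdjoint (c d : ℕ → ℝ) (hc : ∀ j, c j = 1 + d j ^ 2) :
    IsSelfAdjoint (minimalOperator c d) := by
  have hle : finiteOperator c d ≤ minimalOperator c d := LinearPMap.le_closure _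
  refine (minimalOperator_isFormalAdjoint c d).isSelfAdjoint_of_nonneg
    (dense_finitelySupported.mono hle.1) (finiteOperator_isClosable c d).closure_isClosed
    (re_inner_minimalOperator_nonneg c d hc) fun y hy => ?_
  refine eq_zero_of_orthogonal_range c d hc y fun x => ?_
  rw [hle.2 (x := x) (y := ⟨x, hle.1 x.2⟩) rfl]
  exact hy ⟨x, hle.1 x.2⟩

end JacobiOperator

end

theorem mainTheorem5 (c d : ℕ → ℝ) (hd : ∀ j, 0 < d j) (hc : ∀ j, c j = 1 + d j ^ 2) :
    IsSelfAdjoint (JacobiOperator.minimalOperator c d) ∧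
    (∀ x : (JacobiOperator.minimalOperator c d).domain, x ≠ 0 →
      0 < inner ℂ (x : JacobiOperator.Ell2) (JacobiOperator.minimalOperator c d x)) ∧
    LinearMap.ker (JacobiOperator.minimalOperator c d).toFun = ⊥ := by
  have hpos := JacobiOperator.inner_minimalOperator_pos c d hc
  refine ⟨JacobiOperator.minimalOperator_isSelfAdjoint c d hc, hpos, ?_⟩
  refine (Submodule.eq_bot_iff _).2 fun x hx => ?_
  by_contra hne
  have h0 : JacobiOperator.minimalOperator c d x = 0 := hx
  have := hpos x hne
  rw [h0, inner_zero_right] at this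
  exact lt_irrefl _ this
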